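/- Let $\mathcal L$ be a compact Riemann surface, i.e. a compact connected (Hausdorff) complex-analytic manifold of complex dimension $1$, and let $f:\mathcal L\to\mathbb C\cup\{\infty\}$ be a non-constant meromorphic function on $\mathcal L$, i.e. near every point of $\mathcal L$ the function $f$ is either finite and holomorphic, or has a pole at that point and is finite in a punctured neighbourhood of it. Then $f$ has only finitely many poles and only finitely many zeros, and the number of poles equals the number of zeros, where each pole and each zero is counted with its multiplicity (order): $$\sum_{P:\,f(P)=\infty}\bigl(-\operatorname{ord}_P f\bigr)=\sum_{P:\,f(P)=0}\operatorname{ord}_P f ,$$ $\operatorname{ord}_P f\in\mathbb Z$ denoting the exponent of the first non-zero term in the Laurent expansion of $f$ in a local parameter at $P$. -/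

import Mathlib

open scoped Topology Manifold ContDiff

/-- The complex value of a point of the Riemann sphere `ℂ ∪ {∞}`; the value at `∞` is a
convention and is never used as the value of a function. -/
noncomputable def sphereToComplex (w : OnePoint ℂ) : ℂ :=
  w.elim 0 id

section

variable {X : Type*} [TopologicalSpace X] [ChartedSpace ℂ X]

/-- The expression of `f : X → ℂ ∪ {∞}` in the chart of the surface around `P`. The point `P`
itself corresponds to `chartAt ℂ P P`. -/
noncomputable def localRep (f : X → OnePoint ℂ) (P : X) : ℂ → ℂ :=
  fun z => sphereToComplex (f ((chartAt ℂ P).symm z))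

/-- `f` is finite near `P` and holomorphic at `P`. -/
def IsHolomorphicPoint (f : X → OnePoint ℂ) (P : X) : Prop :=
  (∀ᶠ Q in 𝓝 P, f Q ≠ OnePoint.infty) ∧ AnalyticAt ℂ (localRep f P) (chartAt ℂ P P)

/-- `f` takes the value `∞` at `P`, is finite in a punctured neighbourhood of `P`, and in the
local parameter at `P` it is meromorphic of negative order. -/
def IsPolePoint (f : X → OnePoint ℂ) (P : X) : Prop :=
  f P = OnePoint.infty ∧ (∀ᶠ Q in 𝓝[≠] P, f Q ≠ OnePoint.infty) ∧
    MeromorphicAt (localRep f P) (chartAt ℂ P P) ∧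
    meromorphicOrderAt (localRep f P) (chartAt ℂ P P) < 0

/-- A meromorphic function on a Riemann surface: every point is a point of holomorphy or
a pole. -/
def IsMeromorphicFunction (f : X → OnePoint ℂ) : Prop :=
  ∀ P, IsHolomorphicPoint f P ∨ IsPolePoint f P

/-- The poles of `f`. -/
def poleSet (f : X → OnePoint ℂ) : Set X := {P | f P = OnePoint.infty}

/-- The zeros of `f`. -/
def zeroSet (f : X → OnePoint ℂ) : Set X := {P | f P = ((0 : ℂ) : OnePoint ℂ)}

/-- The order of `f` at `P`: the exponent of the first nonzero term of the Laurent expansion of `f`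
in the local parameter at `P`. (It is `0` by convention if `f` vanishes identically near `P`.) -/
noncomputable def orderAt (f : X → OnePoint ℂ) (P : X) : ℤ :=
  (meromorphicOrderAt (localRep f P) (chartAt ℂ P P)).untop₀

/-- The multiplicity of `P` as a zero of `f`. -/
noncomputable def zeroMultiplicity (f : X → OnePoint ℂ) (P : X) : ℕ := (orderAt f P).toNat

/-- The multiplicity of `P` as a pole of `f`. -/
noncomputable def poleMultiplicity (f : X → OnePoint ℂ) (P : X) : ℕ := (-orderAt f P).toNat

end

/-! ### Local degrees and the conservation of number in fibres. -/

section LocalDegree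

open Filter Set

variable {X Y Z W : Type*} [TopologicalSpace X] [TopologicalSpace Y] [TopologicalSpace Z]
  [TopologicalSpace W]

/-! A meromorphic `f` is a continuous map to the Riemann sphere. In suitable coordinates it is `z ↦
z ^ k` near each point (`AnalyticAt.hasLocalDegree`), where `k` is the order of the zero or pole if
the value is `0` or `∞`. By compactness the fibres over all `w ≠ y` close to `y` have as many points
as the local degrees over `y` add up to (`eventually_encard_fiber`). This sum is therefore locally
constant in `y`, hence constant on the connected sphere (`sum_localDegree_fiber_eq`); its values at
`∞` and `0` are the two sides. -/

/-- `F` has local degree `k` at `P`: in arbitrarily small neighbourhoods of `P`, every value close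
to `F P` but different from it is taken exactly `k` times. -/
def HasLocalDegree (F : X → Y) (P : X) (k : ℕ) : Prop :=
  ∀ U ∈ 𝓝 P, ∃ V ∈ 𝓝 P, V ⊆ U ∧ ∀ᶠ w in 𝓝[≠] (F P), (V ∩ F ⁻¹' {w}).encard = k

theorem finite_fiber_of_isolated [CompactSpace X] [T1Space Y] {F : X → Y} (hF : Continuous F)
    (hiso : ∀ P, ∀ᶠ Q in 𝓝[≠] P, F Q ≠ F P) (y : Y) : (F ⁻¹' {y}).Finite := by
  have hcl : IsClosed (F ⁻¹' {y}) := isClosed_singleton.preimage hF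
  by_contra hinf
  obtain ⟨P, hP⟩ := (show (F ⁻¹' {y}).Infinite from hinf).exists_accPt_principal
  rw [accPt_iff_frequently_nhdsNE] at hP
  have hPy : F P = y := by
    have : ∃ᶠ Q in 𝓝 P, Q ∈ F ⁻¹' {y} := hP.filter_mono nhdsWithin_le_nhds
    exact hcl.mem_of_frequently_of_tendsto this tendsto_id
  exact hP ((hiso P).mono fun Q hQ h => hQ (by rw [hPy]; exact h))

/-- Disjoint neighbourhoods of the points of the fibre are counted separately. They miss no preimage
of a nearby `w`, since a continuous map from a compact to a Hausdorff space is closed. -/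
theorem eventually_encard_fiber [CompactSpace X] [T2Space X] [T2Space Y] {F : X → Y}
    (hF : Continuous F) {m : X → ℕ} (hm : ∀ P, HasLocalDegree F P (m P)) {y : Y}
    (hy : (F ⁻¹' {y}).Finite) :
    ∀ᶠ w in 𝓝[≠] y, (F ⁻¹' {w}).encard = (∑ P ∈ hy.toFinset, m P : ℕ) := by
  obtain ⟨U, hU, hdisj⟩ := hy.t2_separation
  have hV : ∀ P, ∃ V ∈ 𝓝 P, V ⊆ U P ∧
      ∀ᶠ w in 𝓝[≠] (F P), (V ∩ F ⁻¹' {w}).encard = m P :=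
    fun P => hm P (U P) ((hU P).2.mem_nhds (hU P).1)
  choose V hVn hVU hVc using hV
  have hcover : ∀ᶠ w in 𝓝 y, F ⁻¹' {w} ⊆ ⋃ P ∈ hy.toFinset, V P := by
    have hnh : ∀ P ∈ F ⁻¹' {y}, (⋃ P ∈ hy.toFinset, V P) ∈ 𝓝 P := by
      intro P hP
      exact mem_of_superset (hVn P) (subset_biUnion_of_mem (u := V) (by simpa using hP))
    exact hF.isClosedMap.eventually_nhds_fiber (p := fun Q => Q ∈ ⋃ P ∈ hy.toFinset, V P) y hnh
  have hcount : ∀ᶠ w in 𝓝[≠] y, ∀ P ∈ hy.toFinset, (V P ∩ F ⁻¹' {w}).encard = m P := by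
    rw [Finset.eventually_all]
    intro P hP
    have : F P = y := by simpa using hP
    simpa only [this] using hVc P
  filter_upwards [nhdsWithin_le_nhds hcover, hcount] with w h1 h2
  have h3 : F ⁻¹' {w} = ⋃ P ∈ hy.toFinset, V P ∩ F ⁻¹' {w} := by
    rw [← iUnion₂_inter]
    exact (inter_eq_right.2 h1).symm
  have h4 : (⋃ P ∈ hy.toFinset, V P ∩ F ⁻¹' {w}).encard
      = ∑ P ∈ hy.toFinset, (V P ∩ F ⁻¹' {w}).encard := by
    have h5 := (hy.toFinset.finite_toSet).encard_biUnion (s := fun P => V P ∩ F ⁻¹' {w}) ?_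
    · rw [finsum_mem_coe_finset] at h5
      exact h5
    intro P hP Q hQ hPQ
    exact (hdisj (by simpa using hP) (by simpa using hQ) hPQ).mono
      (inter_subset_left.trans (hVU P)) (inter_subset_left.trans (hVU Q))
  rw [h3, h4, Finset.sum_congr rfl h2]
  push_cast
  rfl

theorem sum_localDegree_fiber_eq [CompactSpace X] [T2Space X] [T2Space Y] [PreconnectedSpace Y]
    [∀ y : Y, (𝓝[≠] y).NeBot] {F : X → Y} (hF : Continuous F) {m : X → ℕ}
    (hm : ∀ P, HasLocalDegree F P (m P)) (hfin : ∀ y, (F ⁻¹' {y}).Finite) (a b : Y) :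
    ∑ P ∈ (hfin a).toFinset, m P = ∑ P ∈ (hfin b).toFinset, m P := by
  have hloc : IsLocallyConstant fun y => ∑ P ∈ (hfin y).toFinset, m P := by
    rw [IsLocallyConstant.iff_eventually_eq]
    intro y
    have h := eventually_encard_fiber hF hm (hfin y)
    obtain ⟨T, hT, hTo, hyT⟩ := eventually_nhds_iff.1 (eventually_nhdsWithin_iff.1 h)
    filter_upwards [hTo.mem_nhds hyT] with w hw
    by_cases hwy : w = y
    · rw [hwy]
    -- A value `v` close to `w` and different from both `w` and `y` has a fibre that both sums
    -- count.
    have hnear : ∀ᶠ v in 𝓝[≠] w, (F ⁻¹' {v}).encard = (∑ P ∈ (hfin y).toFinset, m P : ℕ) := by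
      apply nhdsWithin_le_nhds
      filter_upwards [hTo.mem_nhds hw, isOpen_compl_singleton.mem_nhds hwy] with v hv hv'
      exact hT v hv hv'
    obtain ⟨v, h1, h2⟩ := (hnear.and (eventually_encard_fiber hF hm (hfin w))).exists
    exact_mod_cast h2.symm.trans h1
  exact hloc.apply_eq_of_preconnectedSpace a b

/-- The local degree does not change under passing to a chart of the source and a punctured
local homeomorphism of the target. -/
theorem HasLocalDegree.comp_chart {F : X → Y} {P : X} {e : OpenPartialHomeomorph X Z}
    (he : P ∈ e.source) {g : Z → W} {φ : W → Y} {k : ℕ} (hg : HasLocalDegree g (e P) k)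
    (hφ : Function.Injective φ)
    (hφn : 𝓝[≠] (φ (g (e P))) ≤ map φ (𝓝[≠] (g (e P))))
    (hF : F =ᶠ[𝓝 P] fun Q => φ (g (e Q))) : HasLocalDegree F P k := by
  intro U hU
  have hU' : {Q | Q ∈ U ∧ F Q = φ (g (e Q))} ∈ 𝓝 P := inter_mem hU hF
  have h1 : e.target ∩ e.symm ⁻¹' {Q | Q ∈ U ∧ F Q = φ (g (e Q))} ∈ 𝓝 (e P) := by
    refine inter_mem (e.open_target.mem_nhds (e.map_source he)) ?_
    apply (e.continuousAt_symm (e.map_source he)).preimage_mem_nhds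
    rwa [e.left_inv he]
  obtain ⟨V, hV, hVU, hVc⟩ := hg _ h1
  refine ⟨e.source ∩ e ⁻¹' V, inter_mem (e.open_source.mem_nhds he)
    ((e.continuousAt he).preimage_mem_nhds hV), ?_, ?_⟩
  · rintro Q ⟨hQ, hQV⟩
    have := (hVU hQV).2.1
    rwa [e.left_inv hQ] at this
  · rw [hF.self_of_nhds]
    apply hφn
    rw [mem_map]
    filter_upwards [hVc] with w hw
    have : e.source ∩ e ⁻¹' V ∩ F ⁻¹' {φ w} = e.symm '' (V ∩ g ⁻¹' {w}) := by
      ext Q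
      constructor
      · rintro ⟨⟨hQ, hQV⟩, hQw⟩
        refine ⟨e Q, ⟨hQV, ?_⟩, e.left_inv hQ⟩
        have h2 := (hVU hQV).2.2
        rw [e.left_inv hQ] at h2
        exact hφ (h2.symm.trans hQw)
      · rintro ⟨z, ⟨hz, hzw⟩, rfl⟩
        have h2 := hVU hz
        refine ⟨⟨e.map_target h2.1, ?_⟩, ?_⟩
        · simpa [e.right_inv h2.1] using hz
        · have h3 := h2.2.2
          rw [e.right_inv h2.1] at h3
          rw [mem_preimage, mem_singleton_iff, h3, show g z = w from hzw]
    rw [mem_preimage, mem_ofPred_eq, this, InjOn.encard_image, hw]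
    exact e.symm.injOn.mono fun z hz => (hVU hz.1).1

end LocalDegree

/-! ### The local normal form of an analytic function. -/

section Analytic

open Filter Set

theorem Complex.encard_setOf_pow_eq {k : ℕ} (hk : k ≠ 0) {a : ℂ} (ha : a ≠ 0) :
    {x : ℂ | x ^ k = a}.encard = k := by
  have hprim := Complex.isPrimitiveRoot_exp k hk
  obtain ⟨b, hb⟩ := IsAlgClosed.exists_pow_nat_eq a (Nat.pos_of_ne_zero hk)
  have hset : {x : ℂ | x ^ k = a} = ((Polynomial.nthRoots k a).toFinset : Set ℂ) := by
    ext x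
    simp [Polynomial.mem_nthRoots (Nat.pos_of_ne_zero hk)]
  rw [hset, Set.encard_coe_eq_coe_finsetCard,
    Multiset.toFinset_card_of_nodup (hprim.nthRoots_nodup ha), hprim.card_nthRoots,
    if_pos ⟨b, hb⟩]

theorem AnalyticAt.exists_pow_eq {u : ℂ → ℂ} {z₀ : ℂ} (hu : AnalyticAt ℂ u z₀) (h0 : u z₀ ≠ 0)
    {k : ℕ} (hk : k ≠ 0) :
    ∃ q : ℂ → ℂ, AnalyticAt ℂ q z₀ ∧ q z₀ ≠ 0 ∧ ∀ z, u z = q z ^ k := by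
  obtain ⟨r, hr⟩ := IsAlgClosed.exists_pow_nat_eq (u z₀) (Nat.pos_of_ne_zero hk)
  have hr0 : r ≠ 0 := by
    rintro rfl
    rw [zero_pow hk] at hr
    exact h0 hr.symm
  -- Dividing by `u z₀` moves the value at `z₀` to `1`, away from the branch cut of the principal
  -- root.
  refine ⟨fun z => r * (u z / u z₀) ^ ((k : ℂ)⁻¹), ?_, ?_, fun z => ?_⟩
  · refine analyticAt_const.mul (AnalyticAt.cpow (hu.div analyticAt_const h0) analyticAt_const ?_)
    simp [div_self h0]
  · simp [div_self h0, hr0]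
  · rw [mul_pow, Complex.cpow_nat_inv_pow _ hk, hr, mul_div_cancel₀ _ h0]

/-- Near `z₀`, `g z - g z₀ = ((z - z₀) * q z) ^ k` with `q z₀ ≠ 0`. By the inverse function theorem
the base of this power is a local coordinate, so nearby fibres correspond to sets of `k`-th roots.
-/
theorem AnalyticAt.hasLocalDegree {g : ℂ → ℂ} {z₀ : ℂ} (hg : AnalyticAt ℂ g z₀) {k : ℕ}
    (hk : k ≠ 0) (hord : analyticOrderAt (fun z => g z - g z₀) z₀ = k) :
    HasLocalDegree g z₀ k := by
  obtain ⟨u, hu, hu0, hgu⟩ :=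
    ((hg.sub analyticAt_const).analyticOrderAt_eq_natCast (n := k)).1 hord
  obtain ⟨q, hq, hq0, hqu⟩ := hu.exists_pow_eq hu0 hk
  have hstrict : HasStrictDerivAt (fun z => (z - z₀) * q z) (q z₀) z₀ := by
    have := HasStrictDerivAt.fun_mul ((hasStrictDerivAt_id z₀).sub_const z₀) hq.hasStrictDerivAt
    simpa using this
  set E := (hstrict.hasStrictFDerivAt_equiv hq0).toOpenPartialHomeomorph _
  have hEa : ∀ z, E z = (z - z₀) * q z := fun z => rfl
  have hz₀ : z₀ ∈ E.source :=
    (hstrict.hasStrictFDerivAt_equiv hq0).mem_toOpenPartialHomeomorph_source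
  have hE0 : E z₀ = 0 := by simp [hEa]
  intro U hU
  have hW : {z | z ∈ U ∧ g z - g z₀ = E z ^ k} ∈ 𝓝 z₀ := by
    filter_upwards [hU, hgu] with z h1 h2
    refine ⟨h1, ?_⟩
    rw [hEa, mul_pow, ← hqu]
    exact h2
  have h1 : E.target ∩ E.symm ⁻¹' {z | z ∈ U ∧ g z - g z₀ = E z ^ k} ∈ 𝓝 (0 : ℂ) := by
    rw [← hE0]
    refine inter_mem (E.open_target.mem_nhds (E.map_source hz₀)) ?_
    apply (E.continuousAt_symm (E.map_source hz₀)).preimage_mem_nhds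
    rwa [E.left_inv hz₀]
  obtain ⟨r, hr, hball⟩ := Metric.mem_nhds_iff.1 h1
  refine ⟨E.source ∩ E ⁻¹' Metric.ball 0 r, inter_mem (E.open_source.mem_nhds hz₀)
    ((E.continuousAt hz₀).preimage_mem_nhds (by rw [hE0]; exact Metric.ball_mem_nhds _ hr)), ?_, ?_⟩
  · rintro z ⟨hz, hzb⟩
    have := (hball hzb).2.1
    rwa [E.left_inv hz] at this
  · filter_upwards [self_mem_nhdsWithin,
      nhdsWithin_le_nhds (Metric.ball_mem_nhds (g z₀) (pow_pos hr k))] with w hw hwb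
    -- The radius `r ^ k` in the target ensures that all `k` roots lie in the coordinate ball.
    have hroot : ∀ x : ℂ, x ^ k = w - g z₀ → x ∈ Metric.ball (0 : ℂ) r := by
      intro x hx
      rw [mem_ball_zero_iff]
      rw [mem_ball_iff_norm, ← hx, norm_pow] at hwb
      exact lt_of_pow_lt_pow_left₀ k hr.le hwb
    have : E.source ∩ E ⁻¹' Metric.ball 0 r ∩ g ⁻¹' {w} = E.symm '' {x | x ^ k = w - g z₀} := by
      ext z
      constructor
      · rintro ⟨⟨hz, hzb⟩, hzw⟩
        refine ⟨E z, ?_, E.left_inv hz⟩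
        have h2 := (hball hzb).2.2
        rw [E.left_inv hz] at h2
        rw [mem_ofPred_eq, ← h2, show g z = w from hzw]
      · rintro ⟨x, hx, rfl⟩
        have hxb := hroot x hx
        have h2 := hball hxb
        refine ⟨⟨E.map_target h2.1, ?_⟩, ?_⟩
        · rwa [mem_preimage, E.right_inv h2.1]
        · have h3 := h2.2.2
          rw [E.right_inv h2.1, show x ^ k = w - g z₀ from hx] at h3
          exact sub_left_injective h3
    rw [this, InjOn.encard_image, Complex.encard_setOf_pow_eq hk (sub_ne_zero.2 hw)]
    exact E.symm.injOn.mono fun x hx => (hball (hroot x hx)).1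

end Analytic

/-! ### Meromorphic functions as maps to the Riemann sphere. -/

section RiemannSurface

open Filter Set

theorem OnePoint.nhdsNE_coe_eq_map {Y : Type*} [TopologicalSpace Y] (y : Y) :
    𝓝[≠] (y : OnePoint Y) = map ((↑) : Y → OnePoint Y) (𝓝[≠] y) := by
  rw [OnePoint.nhdsWithin_coe]
  congr 2
  ext z
  simp

/-- The chart `z ↦ 1 / z` of the Riemann sphere around `∞`. -/
noncomputable def sphereInv (z : ℂ) : OnePoint ℂ :=
  if z = 0 then OnePoint.infty else ((z⁻¹ : ℂ) : OnePoint ℂ)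

theorem sphereInv_zero : sphereInv 0 = OnePoint.infty := if_pos rfl

theorem sphereInv_injective : Function.Injective sphereInv := by
  intro a b hab
  unfold sphereInv at hab
  split_ifs at hab with ha hb hb
  · rw [ha, hb]
  · exact absurd hab (OnePoint.infty_ne_coe _)
  · exact absurd hab (OnePoint.coe_ne_infty _)
  · exact inv_injective (OnePoint.coe_injective hab)

theorem nhdsNE_infty_eq_map_sphereInv :
    𝓝[≠] (OnePoint.infty : OnePoint ℂ) = map sphereInv (𝓝[≠] 0) := by
  rw [OnePoint.nhdsNE_infty_eq, coclosedCompact_eq_cocompact, ← Metric.cobounded_eq_cocompact,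
    ← inv_nhdsNE_zero, ← Filter.map_inv, Filter.map_map]
  apply Filter.map_congr
  filter_upwards [self_mem_nhdsWithin] with z hz
  exact (if_neg hz).symm

theorem continuousAt_sphereInv_zero : ContinuousAt sphereInv 0 := by
  rw [continuousAt_iff_punctured_nhds, sphereInv_zero]
  exact (show Tendsto sphereInv (𝓝[≠] 0) (𝓝[≠] OnePoint.infty) from
    nhdsNE_infty_eq_map_sphereInv.ge).mono_right nhdsWithin_le_nhds

theorem coe_sphereToComplex {w : OnePoint ℂ} (hw : w ≠ OnePoint.infty) :
    ((sphereToComplex w : ℂ) : OnePoint ℂ) = w := by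
  obtain ⟨z, rfl⟩ := OnePoint.ne_infty_iff_exists.1 hw
  rfl

variable {X : Type*} [TopologicalSpace X] [ChartedSpace ℂ X] {f : X → OnePoint ℂ} {P : X}

theorem localRep_chartAt (f : X → OnePoint ℂ) {P Q : X} (hQ : Q ∈ (chartAt ℂ P).source) :
    localRep f P (chartAt ℂ P Q) = sphereToComplex (f Q) := by
  rw [localRep, (chartAt ℂ P).left_inv hQ]

/-- Near `P`, the map `f` is the analytic map `g` in the chart at `P` and in the chart of the
sphere inverse to `φ`. -/
structure IsLocalExpression (f : X → OnePoint ℂ) (P : X) (φ : ℂ → OnePoint ℂ) (g : ℂ → ℂ) :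
    Prop where
  analyticAt : AnalyticAt ℂ g (chartAt ℂ P P)
  injective : Function.Injective φ
  continuousAt : ContinuousAt φ (g (chartAt ℂ P P))
  nhdsNE_eq : 𝓝[≠] (φ (g (chartAt ℂ P P))) = map φ (𝓝[≠] (g (chartAt ℂ P P)))
  eventuallyEq : f =ᶠ[𝓝 P] fun Q => φ (g (chartAt ℂ P Q))

theorem IsHolomorphicPoint.isLocalExpression (h : IsHolomorphicPoint f P) :
    IsLocalExpression f P (↑) (localRep f P) where
  analyticAt := h.2
  injective := OnePoint.coe_injective
  continuousAt := OnePoint.continuous_coe.continuousAt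
  nhdsNE_eq := OnePoint.nhdsNE_coe_eq_map _
  eventuallyEq := by
    filter_upwards [h.1, (chartAt ℂ P).open_source.mem_nhds (mem_chart_source ℂ P)] with Q h1 h2
    rw [localRep_chartAt f h2, coe_sphereToComplex h1]

/-- Both default values matter: `sphereToComplex` sends `∞` to `0`, and `0⁻¹ = 0`. Thus the
reciprocal has the correct value at the pole and is analytic there. -/
theorem IsPolePoint.inv_localRep_eq_zero (h : IsPolePoint f P) :
    (localRep f P)⁻¹ (chartAt ℂ P P) = 0 := by
  rw [Pi.inv_apply, localRep_chartAt f (mem_chart_source ℂ P), h.1]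
  exact inv_zero

theorem IsPolePoint.isLocalExpression (h : IsPolePoint f P) :
    IsLocalExpression f P sphereInv (localRep f P)⁻¹ where
  analyticAt := by
    refine AnalyticAt.of_meromorphicOrderAt_pos ?_ h.inv_localRep_eq_zero
    rw [meromorphicOrderAt_inv]
    have h4 := h.2.2.2
    have hne : meromorphicOrderAt (localRep f P) (chartAt ℂ P P) ≠ ⊤ := h4.ne_top
    lift meromorphicOrderAt (localRep f P) (chartAt ℂ P P) to ℤ using hne with n
    have h5 : n < 0 := by exact_mod_cast h4
    have h6 : 0 < -n := by omega
    exact_mod_cast h6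
  injective := sphereInv_injective
  continuousAt := by
    rw [h.inv_localRep_eq_zero]
    exact continuousAt_sphereInv_zero
  nhdsNE_eq := by
    rw [h.inv_localRep_eq_zero, sphereInv_zero]
    exact nhdsNE_infty_eq_map_sphereInv
  eventuallyEq := by
    -- Inverting twice recovers `f` only where it does not vanish, which holds near a pole because
    -- `f` tends to infinity.
    have hne : ∀ᶠ z in 𝓝[≠] (chartAt ℂ P P), localRep f P z ≠ 0 :=
      (tendsto_cobounded_of_meromorphicOrderAt_neg h.2.2.2).eventually_ne_cobounded 0
    have hne' := (chartAt ℂ P).continuousAt (mem_chart_source ℂ P) |>.eventually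
      (eventually_nhdsWithin_iff.1 hne)
    filter_upwards [hne', eventually_nhdsWithin_iff.1 h.2.1,
      (chartAt ℂ P).open_source.mem_nhds (mem_chart_source ℂ P)] with Q h1 h2 h3
    by_cases hQ : Q = P
    · rw [hQ, h.inv_localRep_eq_zero, h.1, sphereInv_zero]
    · have h4 := h1 fun h5 => hQ ((chartAt ℂ P).injOn h3 (mem_chart_source ℂ P) h5)
      rw [sphereInv, if_neg (by simpa using h4), Pi.inv_apply, inv_inv, localRep_chartAt f h3,
        coe_sphereToComplex (h2 hQ)]

namespace IsLocalExpression

variable {φ : ℂ → OnePoint ℂ} {g : ℂ → ℂ}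

theorem continuousAt_left (h : IsLocalExpression f P φ g) : ContinuousAt f P := by
  have hc : ContinuousAt (fun Q => φ (g (chartAt ℂ P Q))) P :=
    ContinuousAt.comp (g := φ) (f := fun Q => g (chartAt ℂ P Q)) h.continuousAt
      (ContinuousAt.comp (g := g) (f := chartAt ℂ P) h.analyticAt.continuousAt
        ((chartAt ℂ P).continuousAt (mem_chart_source ℂ P)))
  exact hc.congr h.eventuallyEq.symm

theorem eventually_eq_or_ne (h : IsLocalExpression f P φ g) :
    (∀ᶠ Q in 𝓝 P, f Q = f P) ∨ ∀ᶠ Q in 𝓝[≠] P, f Q ≠ f P := by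
  have hc := (chartAt ℂ P).continuousAt (mem_chart_source ℂ P)
  have hP := h.eventuallyEq.self_of_nhds
  rcases h.analyticAt.eventually_eq_or_eventually_ne
    (analyticAt_const (v := g (chartAt ℂ P P))) with h1 | h1
  · left
    filter_upwards [h.eventuallyEq, hc.eventually h1] with Q h2 h3
    rw [h2, hP, h3]
  · right
    rw [eventually_nhdsWithin_iff] at h1 ⊢
    filter_upwards [h.eventuallyEq, hc.eventually h1,
      (chartAt ℂ P).open_source.mem_nhds (mem_chart_source ℂ P)] with Q h2 h3 h4 hQ h5
    refine h3 (fun h6 => hQ ((chartAt ℂ P).injOn h4 (mem_chart_source ℂ P) h6)) ?_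
    exact h.injective (h2.symm.trans (h5.trans hP))

theorem hasLocalDegree (h : IsLocalExpression f P φ g) (hiso : ¬ ∀ᶠ Q in 𝓝 P, f Q = f P) :
    HasLocalDegree f P
      (analyticOrderNatAt (fun z => g z - g (chartAt ℂ P P)) (chartAt ℂ P P)) := by
  have han : AnalyticAt ℂ (fun z => g z - g (chartAt ℂ P P)) (chartAt ℂ P P) :=
    h.analyticAt.sub analyticAt_const
  have htop : analyticOrderAt (fun z => g z - g (chartAt ℂ P P)) (chartAt ℂ P P) ≠ ⊤ := by
    intro h1
    refine hiso ?_
    rw [analyticOrderAt_eq_top] at h1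
    filter_upwards [h.eventuallyEq,
      ((chartAt ℂ P).continuousAt (mem_chart_source ℂ P)).eventually h1] with Q h2 h3
    rw [h2, h.eventuallyEq.self_of_nhds, sub_eq_zero.1 h3]
  have hcast := Nat.cast_analyticOrderNatAt htop
  have hne : analyticOrderNatAt (fun z => g z - g (chartAt ℂ P P)) (chartAt ℂ P P) ≠ 0 := by
    intro h1
    rw [h1, Nat.cast_zero, eq_comm, han.analyticOrderAt_eq_zero] at hcast
    exact hcast (sub_self _)
  exact (h.analyticAt.hasLocalDegree hne hcast.symm).comp_chart (mem_chart_source ℂ P)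
    h.injective h.nhdsNE_eq.le h.eventuallyEq

end IsLocalExpression

theorem AnalyticAt.untop₀_meromorphicOrderAt {g : ℂ → ℂ} {z : ℂ} (hg : AnalyticAt ℂ g z) :
    (meromorphicOrderAt g z).untop₀ = analyticOrderNatAt g z := by
  rw [hg.meromorphicOrderAt_eq, analyticOrderNatAt]
  cases analyticOrderAt g z <;> rfl

theorem IsPolePoint.poleMultiplicity_eq (h : IsPolePoint f P) :
    poleMultiplicity f P = analyticOrderNatAt
      (fun z => (localRep f P)⁻¹ z - (localRep f P)⁻¹ (chartAt ℂ P P)) (chartAt ℂ P P) := by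
  have h1 := h.isLocalExpression.analyticAt.untop₀_meromorphicOrderAt
  rw [meromorphicOrderAt_inv, WithTop.untop₀_neg] at h1
  simp only [h.inv_localRep_eq_zero, sub_zero]
  rw [poleMultiplicity, orderAt, h1, Int.toNat_natCast]

theorem IsHolomorphicPoint.zeroMultiplicity_eq (h : IsHolomorphicPoint f P)
    (h0 : f P = ((0 : ℂ) : OnePoint ℂ)) :
    zeroMultiplicity f P = analyticOrderNatAt
      (fun z => localRep f P z - localRep f P (chartAt ℂ P P)) (chartAt ℂ P P) := by
  have h1 : localRep f P (chartAt ℂ P P) = 0 := by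
    rw [localRep_chartAt f (mem_chart_source ℂ P), h0]
    rfl
  simp only [h1, sub_zero]
  rw [zeroMultiplicity, orderAt, h.2.untop₀_meromorphicOrderAt, Int.toNat_natCast]

/-! ### Continuity, the identity theorem and finiteness of fibres. -/

namespace IsMeromorphicFunction

theorem exists_isLocalExpression (hf : IsMeromorphicFunction f) (P : X) :
    ∃ φ g, IsLocalExpression f P φ g := by
  rcases hf P with h | h
  · exact ⟨_, _, h.isLocalExpression⟩
  · exact ⟨_, _, h.isLocalExpression⟩

theorem continuous (hf : IsMeromorphicFunction f) : Continuous f := by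
  rw [continuous_iff_continuousAt]
  intro P
  obtain ⟨φ, g, h⟩ := hf.exists_isLocalExpression P
  exact h.continuousAt_left

/-- The identity theorem: a meromorphic function that is constant near some point of a connected
surface is constant. -/
theorem not_eventually_eq [PreconnectedSpace X] (hf : IsMeromorphicFunction f)
    (hconst : ¬ ∃ c : OnePoint ℂ, ∀ P : X, f P = c) (P : X) : ¬ ∀ᶠ Q in 𝓝 P, f Q = f P := by
  intro hP
  -- At a closure point of this interior `f` still has the value `f P`, and this value is not
  -- isolated there, so `f` is locally constant.
  have hclopen : IsClopen (interior (f ⁻¹' {f P})) := by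
    refine ⟨?_, isOpen_interior⟩
    rw [← closure_subset_iff_isClosed]
    intro Q hQ
    by_contra hQi
    have hQc : f Q = f P :=
      closure_minimal interior_subset (isClosed_singleton.preimage hf.continuous) hQ
    obtain ⟨φ, g, h⟩ := hf.exists_isLocalExpression Q
    rcases h.eventually_eq_or_ne with h1 | h1
    · rw [hQc] at h1
      exact hQi (mem_interior_iff_mem_nhds.2 h1)
    · rw [hQc, eventually_nhdsWithin_iff] at h1
      obtain ⟨R, hR, hRi⟩ := mem_closure_iff_nhds.1 hQ _ h1
      exact hR (fun h2 => hQi (by rwa [← show R = Q from h2]))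
        (show R ∈ f ⁻¹' {f P} from interior_subset hRi)
  have huniv := hclopen.eq_univ ⟨P, mem_interior_iff_mem_nhds.2 hP⟩
  exact hconst ⟨f P, fun Q => show Q ∈ f ⁻¹' {f P} from
    interior_subset (huniv ▸ mem_univ Q : Q ∈ interior (f ⁻¹' {f P}))⟩

theorem exists_hasLocalDegree [PreconnectedSpace X] (hf : IsMeromorphicFunction f)
    (hconst : ¬ ∃ c : OnePoint ℂ, ∀ P : X, f P = c) (P : X) :
    ∃ k, HasLocalDegree f P k ∧ (f P = OnePoint.infty → poleMultiplicity f P = k) ∧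
      (f P = ((0 : ℂ) : OnePoint ℂ) → zeroMultiplicity f P = k) := by
  have hP := hf.not_eventually_eq hconst P
  rcases hf P with h | h
  · exact ⟨_, h.isLocalExpression.hasLocalDegree hP,
      fun h1 => absurd h1 h.1.self_of_nhds, h.zeroMultiplicity_eq⟩
  · refine ⟨_, h.isLocalExpression.hasLocalDegree hP, fun _ => h.poleMultiplicity_eq, fun h1 => ?_⟩
    exact absurd (h.1.symm.trans h1) (OnePoint.infty_ne_coe _)

theorem finite_fiber [CompactSpace X] [PreconnectedSpace X] (hf : IsMeromorphicFunction f)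
    (hconst : ¬ ∃ c : OnePoint ℂ, ∀ P : X, f P = c) (c : OnePoint ℂ) : (f ⁻¹' {c}).Finite := by
  refine finite_fiber_of_isolated hf.continuous (fun P => ?_) c
  obtain ⟨φ, g, h⟩ := hf.exists_isLocalExpression P
  exact h.eventually_eq_or_ne.resolve_left (hf.not_eventually_eq hconst P)

end IsMeromorphicFunction

end RiemannSurface

theorem theorem5 {X : Type*} [TopologicalSpace X] [T2Space X] [CompactSpace X] [ConnectedSpace X]
    [ChartedSpace ℂ X] [IsManifold 𝓘(ℂ) ω X]
    (f : X → OnePoint ℂ) (hf : IsMeromorphicFunction f)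
    (hconst : ¬ ∃ c : OnePoint ℂ, ∀ P : X, f P = c) :
    ∃ (hP : (poleSet f).Finite) (hZ : (zeroSet f).Finite),
      ∑ P ∈ hP.toFinset, poleMultiplicity f P = ∑ P ∈ hZ.toFinset, zeroMultiplicity f P := by
  have hfin := hf.finite_fiber hconst
  choose m hm hpole hzero using hf.exists_hasLocalDegree hconst
  refine ⟨hfin OnePoint.infty, hfin ((0 : ℂ) : OnePoint ℂ), ?_⟩
  refine (Finset.sum_congr rfl fun P hP => hpole P ?_).trans
    (Eq.trans ?_ (Finset.sum_congr rfl fun P hP => (hzero P ?_).symm))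
  · exact (Set.Finite.mem_toFinset (hfin _)).1 hP
  swap
  · exact (Set.Finite.mem_toFinset (hfin _)).1 hP
  exact sum_localDegree_fiber_eq hf.continuous hm hfin _ _
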